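/- \textbf{Setting.} Rings are commutative with $1$. A directed acyclic multigraph (DAMG) $G=(V,E)$ consists of finite sets $V$ of vertices and $E$ of (possibly parallel) directed edges, each with a tail and a head in $V$, such that $V$ has a total order in which every tail precedes its head. $E(x,y)$ is the set of edges from $x$ to $y$, $\mathrm{Pa}(y)=\{x: E(x,y)\ne\emptyset\}$, $\mathrm{Anc}(y)$ and $\mathrm{Desc}(y)$ are the sets of ancestors and descendants of $y$ (both containing $y$), $\mathrm{Rt}(G)=\{x:\mathrm{Pa}(x)=\emptyset\}$ is the set of roots, and a leaf is a vertex without children. $G$ is hierarchically flat if every vertex is a root or a leaf. For an edge weight function $f$ put $f(x,y)=\sum_{e\in E(x,y)}f(e)$; its total path weight function is $\sigma(x,y)=0$ if $y\notin\mathrm{Desc}(x)$, $\sigma(x,x)=1$, and $\sigma(x,y)=\sum_{z\in\mathrm{Pa}(y)}\sigma(x,z)f(z,y)$ otherwise. Let $R$ be a ring. An $R$-DAMG $(G,\varsigma,\tau)$ is a DAMG with maps $\varsigma:E\to R$ and $\tau:\mathrm{Rt}(G)\to R$; $\tau$ is extended to $V$ by $\tau(y)=\sum_{z\in\mathrm{Pa}(y)}\tau(z)\varsigma(z,y)$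 for non-roots $y$. The induced projection weights are $q(e)=\frac{\tau(x)}{\tau(y)}\varsigma(e)$ for an edge $e$ from $x$ to $y$, formed in the localization of $R$ at the multiplicative set generated by the $\tau(y)$, $y$ a non-root, and $R_q$ is the $R$-subalgebra generated by all $q(e)$. (If some such $\tau(y)$ is $0$, then $R_q=0$ and the claims for that $R$-DAMG are trivial.) Throughout, $\tau(y)/\tau(y)$ is read as $1$. A value function is a map $v:V\to A$ into an abelian group; its synergy function is defined by $v'_G(x)=v(x)-\sum_{y\in\mathrm{Anc}(x)\setminus\{x\}}v'_G(y)$. A vertex $z$ is weak for $v$ if $v'_G(z)=0$, and null if $v'_G(x)=0$ for all $x\in\mathrm{Desc}(z)$. The unanimity function $\zeta_y$ is $1$ on $\mathrm{Desc}(y)$ and $0$ elsewhere. For $S\subseteq V$, the projected graph $G^{\setminus S}$ has vertex set $V\setminus S$ and as edges from $x$ to $y$ the nonempty directed paths $e_1\cdots e_m$ of $G$ from $x$ to $y$ whose intermediate vertices all lie in $S$; $\varsigma^{\setminus S}(e_1\cdots e_m)=\prod_i\varsigma(e_i)$, and $\tau^{\setminus S}$ is given on $\mathrm{Rt}(G^{\setminus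 S})$ by the extended $\tau$. For edge weights $q$ and a function $w$ on $V$ with values in a module, projecting out one vertex $z$ replaces $w$ by $w(x)+q(x,z)w(z)$ and the pairwise weights by $q(x,y)+q(x,z)q(z,y)$; $w^{\setminus S}$ results from doing so successively for all $z\in S$ (in any order), and $v^{\setminus S}(y)=\sum_{x\in\mathrm{Anc}(y)}w^{\setminus S}(x)$ with $w=v'_G$ and $\mathrm{Anc}$ taken in $G^{\setminus S}$. Call $q$ normalized if $\sum_x q(x,y)=1$ for every non-root $y$; the Shapley values of such a pair (a PDAMG) are $\mathrm{Sh}^{(G,q)}_r(v)=w^{\setminus S}(r)$ with $w=v'_G$, $S=V\setminus\mathrm{Rt}(G)$, for $r\in\mathrm{Rt}(G)$. If $S$ contains no root, an $R_q$-module for $G$ is regarded as an $R_q$-module for $(G^{\setminus S},\varsigma^{\setminus S},\tau^{\setminus S})$ along the canonical $R$-algebra map between the two rings. \textbf{Theorem.} For every $R$-DAMG and every vertex $y$ one has $\tau(y)=\sum_{u\in\mathrm{Rt}(G)}\tau(u)\sigma(u,y)$, with $\sigma$ the total path weight function of $\varsigma$. Let $\mathrm{Sh}$ be a rule that assigns to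 every $R$-DAMG $(G,\varsigma,\tau)$, $R_q$-module $A$, $v:V\to A$ and $r\in\mathrm{Rt}(G)$ an element $\mathrm{Sh}^{(G,\varsigma,\tau)}_r(v)\in A$, such that, for all such data: \begin{enumerate} \item ($A$-linearity) $\mathrm{Sh}_r(\sum_{i\in I}v_i a_i)=\sum_{i\in I}\mathrm{Sh}_r(v_i)\,a_i$ for finite $I$, $v_i:V\to R_q$, $a_i\in A$; \item (weak elements) $\mathrm{Sh}^{(G,\varsigma,\tau)}_r(v)=\mathrm{Sh}^{(G^{\setminus W},\varsigma^{\setminus W},\tau^{\setminus W})}_r(v|_{V\setminus W})$ for every set $W\subseteq V\setminus\mathrm{Rt}(G)$ of weak elements for $v$; \item (weighted flat hierarchy) if $G$ is hierarchically flat and $y\in V$, then in $R_q$ one has $\mathrm{Sh}_r(\zeta_y)=\delta_{y}(r)$ if $y$ is a root, and $\mathrm{Sh}_r(\zeta_y)=\dfrac{\tau(r)\varsigma(r,y)}{\sum_{u\in\mathrm{Rt}(G)}\tau(u)\varsigma(u,y)}$ otherwise. \end{enumerate} Then, for all such data, the following hold: \begin{enumerate} \setcounter{enumi}{3} \item (explicit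 formula) $\mathrm{Sh}^{(G,\varsigma,\tau)}_r(v)=\sum_{y\in V}\frac{\tau(r)}{\tau(y)}\sigma(r,y)\,v'_G(y)$, with all coefficients in $R_q$; \item (induced projection weights) $q$ is normalized and $\mathrm{Sh}^{(G,\varsigma,\tau)}_r(v)=\mathrm{Sh}^{(G,q)}_r(v)$; \item ($R$-linearity) $\mathrm{Sh}_r(c_1v_1+c_2v_2)=c_1\mathrm{Sh}_r(v_1)+c_2\mathrm{Sh}_r(v_2)$ for $c_1,c_2\in R_q$; \item (efficiency) $\sum_{r\in\mathrm{Rt}(G)}\mathrm{Sh}_r(v)=\sum_{x\in V}v'_G(x)$; \item (null root) $\mathrm{Sh}_r(v)=0$ if $r$ is a null root for $v$; \item (projection) $\mathrm{Sh}^{(G,\varsigma,\tau)}_r(v)=\mathrm{Sh}^{(G^{\setminus S},\varsigma^{\setminus S},\tau^{\setminus S})}_r(v^{\setminus S})$ for every $S\subseteq V\setminus\mathrm{Rt}(G)$, with $v^{\setminus S}$ formed with the weights $q$; \item (symmetry) for every automorphism $\alpha$ of $(G,\varsigma,\tau)$ (bijections of $V$ and of $E$ compatible with tails and heads and preserving $\varsigma$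 and $\tau$), $\mathrm{Sh}_{\alpha(r)}(v)=\mathrm{Sh}_r(v\circ\alpha)$; and if $v'_G(\alpha(y))=v'_G(y)$ for all $y\in\mathrm{Desc}(r)$, then $\mathrm{Sh}_{\alpha(r)}(v)=\mathrm{Sh}_r(v)$. \end{enumerate} Conversely, the rule defined by the formula in (4) satisfies all of (1)--(10). -/

import Mathlib

universe u v w

/-- A directed acyclic multigraph: finitely many vertices and (possibly parallel) edges, each edge
`e` pointing from its tail `t e` to its head `h e`, such that a topological ordering exists. -/
structure DAMG where
  V : Type v
  E : Type v
  finV : Finite V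
  finE : Finite E
  t : E → V
  h : E → V
  exists_topologicalOrder :
    ∃ lt : V → V → Prop, IsStrictTotalOrder V lt ∧ ∀ e : E, lt (t e) (h e)

namespace DAMG

attribute [instance] DAMG.finV DAMG.finE

noncomputable instance instFintypeV (G : DAMG.{v}) : Fintype G.V := Fintype.ofFinite _

noncomputable instance instFintypeE (G : DAMG.{v}) : Fintype G.E := Fintype.ofFinite _

variable (G : DAMG.{v})

/-- `x ∈ Pa(y)`. -/
def IsParent (x y : G.V) : Prop := ∃ e : G.E, G.t e = x ∧ G.h e = y

def IsRoot (x : G.V) : Prop := ∀ y, ¬ G.IsParent y x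

def IsLeaf (x : G.V) : Prop := ∀ y, ¬ G.IsParent x y

/-- `x ∈ Anc(y)`, equivalently `y ∈ Desc(x)`: there is a directed path, possibly trivial,
from `x` to `y`. -/
def IsAnc (x y : G.V) : Prop := Relation.ReflTransGen G.IsParent x y

/-- The type of roots of `G`. -/
abbrev Root : Type v := {r : G.V // G.IsRoot r}

/-- `V = Rt(G) ∪ Lf(G)`. -/
def IsFlat : Prop := ∀ x : G.V, G.IsRoot x ∨ G.IsLeaf x

theorem isParent_wf : WellFounded G.IsParent := by
  obtain ⟨lt, hlt, he⟩ := G.exists_topologicalOrder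
  have hwf : WellFounded lt := Finite.wellFounded_of_trans_of_irrefl lt
  refine Subrelation.wf ?_ hwf
  rintro x y ⟨e, rfl, rfl⟩
  exact he e

theorem strictAnc_wf : WellFounded fun y x : G.V => G.IsAnc y x ∧ y ≠ x := by
  refine Subrelation.wf ?_ G.isParent_wf.transGen
  rintro y x ⟨h1, h2⟩
  rcases Relation.reflTransGen_iff_eq_or_transGen.1 h1 with h | h
  · exact absurd h.symm h2
  · exact h

/-- The pairwise weight `f(x,y)`, the sum of `f(e)` over all edges `e` from `x` to `y`. -/
noncomputable def pairWeight {K : Type u} [AddCommMonoid K] (f : G.E → K) (x y : G.V) : K :=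
  open scoped Classical in ∑ e : G.E with G.t e = x ∧ G.h e = y, f e

/-- The total path weight function of an edge weight function `f`, by recursion on the
second argument. -/
noncomputable def totalWeight {K : Type u} [CommRing K] (f : G.E → K) (x : G.V) : G.V → K :=
  open scoped Classical in
  G.isParent_wf.fix fun y s =>
    if ¬ G.IsAnc x y then 0
    else if y = x then 1
    else ∑ z : {z : G.V // G.IsParent z y}, s z.1 z.2 * G.pairWeight f z.1 y

/-- The synergy function (Möbius transform) `v'_G` of a value function `v`:
`v'_G(x) = v(x) - ∑_{y ∈ Anc(x) \ {x}} v'_G(y)`. -/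
noncomputable def synergy {A : Type u} [AddCommGroup A] (v : G.V → A) : G.V → A :=
  open scoped Classical in
  G.strictAnc_wf.fix fun x w => v x - ∑ y : {y : G.V // G.IsAnc y x ∧ y ≠ x}, w y.1 y.2

/-- The unanimity value function centred at `y`. -/
noncomputable def unanimity (K : Type u) [CommRing K] (y : G.V) : G.V → K :=
  open scoped Classical in fun x => if G.IsAnc y x then 1 else 0

/-- `z` is a weak element for `(G,v)`. -/
def IsWeak {A : Type u} [AddCommGroup A] (v : G.V → A) (z : G.V) : Prop := G.synergy v z = 0

/-- `y` is a null element for `(G,v)`. -/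
def IsNull {A : Type u} [AddCommGroup A] (v : G.V → A) (y : G.V) : Prop :=
  ∀ x, G.IsAnc y x → G.synergy v x = 0

/-! ### Projections onto the complement of a set of vertices

Projecting out one vertex `z` deletes `z`, keeps the edges not meeting `z`, and adds an edge
`e₁e₂` from `x` to `y` for every pair of edges `e₁ : x → z`, `e₂ : z → y`.  Projecting out the
elements of `S` one after the other thus gives the graph on `V \ S` whose edges from `x` to `y`
are the words `e₁e₂⋯eₘ`, `m ≥ 1`, that are directed paths of `G` from `x` to `y` all of whose
intermediate vertices are in `S`; an edge weight of such a word is the product of the weights of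
its letters. -/

/-- The words of edges that are the edges of the projection of `G` onto the complement of `S`. -/
def IsWord (S : Finset G.V) (l : List G.E) : Prop :=
  l.IsChain (fun e f => G.h e = G.t f ∧ G.h e ∈ S) ∧
    ∃ hl : l ≠ [], G.t (l.head hl) ∉ S ∧ G.h (l.getLast hl) ∉ S

theorem chain_lt {S : Finset G.V} {lt : G.V → G.V → Prop} [IsStrictTotalOrder G.V lt]
    (he : ∀ e : G.E, lt (G.t e) (G.h e)) (l : List G.E)
    (h : l.IsChain (fun e f => G.h e = G.t f ∧ G.h e ∈ S)) (hl : l ≠ []) :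
    lt (G.t (l.head hl)) (G.h (l.getLast hl)) := by
  induction l with
  | nil => exact absurd rfl hl
  | cons e l ih =>
    cases l with
    | nil => simpa using he e
    | cons f l =>
      rw [List.isChain_cons_cons] at h
      have h2 := ih h.2 (by simp)
      simp only [List.head_cons] at h2 ⊢
      rw [List.getLast_cons (by simp)]
      rw [← h.1.1] at h2
      exact _root_.trans (he e) h2

theorem chain_nodup {S : Finset G.V} (l : List G.E)
    (h : l.IsChain (fun e f => G.h e = G.t f ∧ G.h e ∈ S)) : l.Nodup := by
  obtain ⟨lt, hlt, he⟩ := G.exists_topologicalOrder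
  have h1 : l.IsChain (fun e f => lt (G.h e) (G.h f)) :=
    h.imp fun e f hef => by rw [hef.1]; exact he f
  have : IsTrans G.E (fun e f => lt (G.h e) (G.h f)) := ⟨fun _ _ _ a b => _root_.trans a b⟩
  have h2 := List.isChain_iff_pairwise.1 h1
  refine h2.imp ?_
  rintro a b hab rfl
  exact irrefl _ hab

theorem finite_words (S : Finset G.V) : Finite {l : List G.E // G.IsWord S l} := by
  classical
  refine Finite.of_injective
    (fun l : {l : List G.E // G.IsWord S l} =>
      (⟨l.1, G.chain_nodup l.1 l.2.1⟩ : {l : List G.E // l.Nodup})) ?_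
  intro a b hab
  exact Subtype.ext (congrArg (fun x : {l : List G.E // l.Nodup} => x.1) hab)

/-- The projection of `G` onto the complement of `S`. -/
def proj (S : Finset G.V) : DAMG.{v} where
  V := {x : G.V // x ∉ S}
  E := {l : List G.E // G.IsWord S l}
  finV := inferInstance
  finE := G.finite_words S
  t l := ⟨G.t (l.1.head l.2.2.choose), l.2.2.choose_spec.1⟩
  h l := ⟨G.h (l.1.getLast l.2.2.choose), l.2.2.choose_spec.2⟩
  exists_topologicalOrder := by
    obtain ⟨lt, hlt, he⟩ := G.exists_topologicalOrder
    refine ⟨fun x y => lt x.1 y.1, ?_, fun l => G.chain_lt he l.1 l.2.1 _⟩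
    exact (RelEmbedding.preimage (Function.Embedding.subtype fun x => x ∉ S) lt).isStrictTotalOrder

/-- Projecting out `z` changes pairwise weights to `q(x|y) + q(x|z) q(z|y)`. -/
def projPair {X : Type v} {K : Type u} [CommRing K] (q : X → X → K) (z : X) : X → X → K :=
  fun x y => q x y + q x z * q z y

/-- Projecting out `z` changes a synergy function to `w(x) + q(x|z) w(z)`. -/
def projSyn {X : Type v} {K : Type u} [CommRing K] {A : Type w} [AddCommGroup A] [Module K A]
    (q : X → X → K) (z : X) (w : X → A) : X → A :=
  fun x => w x + q x z • w z

/-- Projecting out the elements of a list successively.  The functions are kept total; their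
values at vertices that have already been projected out are never used again. -/
def projSynList {X : Type v} {K : Type u} [CommRing K] {A : Type w} [AddCommGroup A] [Module K A] :
    List X → (X → X → K) → (X → A) → X → A
  | [], _, w => w
  | z :: l, q, w => projSynList l (projPair q z) (projSyn q z w)

/-- The projection `w^{\S}` of `w` w.r.t. the edge weights `q`: the elements of `S` are projected
out one after the other (the result does not depend on the order). -/
noncomputable def projSynergy {K : Type u} [CommRing K] {A : Type w} [AddCommGroup A] [Module K A]
    (q : G.E → K) (S : Finset G.V) (w : G.V → A) : (G.proj S).V → A :=
  fun x => projSynList S.toList (G.pairWeight q) w x.1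

/-- The projection `v^{\S}` of a value function:
`v^{\S}(y) = ∑_{x ∈ Anc(y)} w^{\S}(x)`, with `Anc` taken in the projected graph. -/
noncomputable def projValue {K : Type u} [CommRing K] {A : Type w} [AddCommGroup A] [Module K A]
    (q : G.E → K) (S : Finset G.V) (v : G.V → A) : (G.proj S).V → A :=
  open scoped Classical in
  fun y => ∑ x : (G.proj S).V with (G.proj S).IsAnc x y, G.projSynergy q S (G.synergy v) x

/-- The restriction of a value function to `V \ S`. -/
def restrict {A : Type w} (S : Finset G.V) (v : G.V → A) : (G.proj S).V → A := fun x => v x.1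

theorem isRoot_proj {S : Finset G.V} (x : (G.proj S).V) (hx : G.IsRoot x.1) :
    (G.proj S).IsRoot x := by
  rintro y ⟨l, -, hl⟩
  refine hx (G.t (l.1.getLast l.2.2.choose)) ⟨l.1.getLast l.2.2.choose, rfl, ?_⟩
  rw [← hl]
  rfl

/-- A root of `G`, as a root of the projection onto the complement of a set of non-roots. -/
def projRoot (S : Finset G.V) (hS : ∀ z ∈ S, ¬ G.IsRoot z) (r : G.Root) : (G.proj S).Root :=
  ⟨⟨r.1, fun h => hS _ h r.2⟩, G.isRoot_proj _ r.2⟩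

open scoped Classical in
theorem sum_parents {K : Type w} [CommRing K] (f : G.V → K) (g : G.E → K) (y : G.V) :
    ∑ z : {z : G.V // G.IsParent z y}, f z.1 * G.pairWeight g z.1 y
      = ∑ e : G.E with G.h e = y, f (G.t e) * g e := by
  have h1 : ∑ z : {z : G.V // G.IsParent z y}, f z.1 * G.pairWeight g z.1 y
      = ∑ z : G.V, f z * G.pairWeight g z y := by
    rw [← Finset.sum_subtype (Finset.univ.filter fun z => G.IsParent z y) (by simp)
      (fun z => f z * G.pairWeight g z y)]
    refine Finset.sum_subset (Finset.subset_univ _) fun z _ hz => ?_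
    have hz' : ¬ G.IsParent z y := by simpa using hz
    rw [pairWeight, Finset.filter_false_of_mem, Finset.sum_empty, mul_zero]
    intro e _ he
    exact hz' ⟨e, he⟩
  rw [h1, ← Finset.sum_fiberwise (Finset.univ.filter fun e : G.E => G.h e = y) G.t]
  refine Finset.sum_congr rfl fun z _ => ?_
  rw [pairWeight, Finset.mul_sum, Finset.filter_filter]
  refine Finset.sum_congr (by ext e; simp [and_comm]) fun e he => ?_
  simp only [Finset.mem_filter] at he
  rw [he.2.2]

open scoped Classical in
theorem sum_pairWeight {K : Type w} [CommRing K] (g : G.E → K) (y : G.V) :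
    ∑ x, G.pairWeight g x y = ∑ e : G.E with G.h e = y, g e := by
  rw [← Finset.sum_fiberwise (Finset.univ.filter fun e : G.E => G.h e = y) G.t]
  refine Finset.sum_congr rfl fun z _ => ?_
  rw [pairWeight, Finset.filter_filter]
  exact Finset.sum_congr (by ext e; simp [and_comm]) fun _ _ => rfl

open scoped Classical in
theorem totalWeight_eq {K : Type u} [CommRing K] (f : G.E → K) (x y : G.V) :
    G.totalWeight f x y = if ¬ G.IsAnc x y then 0 else if y = x then 1 else
      ∑ e : G.E with G.h e = y, G.totalWeight f x (G.t e) * f e := by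
  rw [← G.sum_parents (G.totalWeight f x) f y]
  conv_lhs => rw [totalWeight, WellFounded.fix_eq]
  rfl

theorem totalWeight_root {K : Type u} [CommRing K] (f : G.E → K) {x y : G.V} (hxy : x ≠ y)
    (hy : G.IsRoot y) : G.totalWeight f x y = 0 := by
  rw [totalWeight_eq, if_pos]
  intro h
  rcases Relation.ReflTransGen.cases_tail h with h | ⟨z, -, h⟩
  · exact hxy h.symm
  · exact hy z h

/-- Directed paths to `y` with tail outside `S` and all intermediate vertices in `S`. -/
def IsPreWord (S : Finset G.V) (y : G.V) (l : List G.E) : Prop :=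
  l.IsChain (fun e f => G.h e = G.t f ∧ G.h e ∈ S) ∧
    ∃ hl : l ≠ [], G.t (l.head hl) ∉ S ∧ G.h (l.getLast hl) = y

theorem finite_preWords (S : Finset G.V) (y : G.V) :
    Finite {l : List G.E // G.IsPreWord S y l} := by
  classical
  refine Finite.of_injective
    (fun l : {l : List G.E // G.IsPreWord S y l} =>
      (⟨l.1, G.chain_nodup l.1 l.2.1⟩ : {l : List G.E // l.Nodup})) ?_
  intro a b hab
  exact Subtype.ext (congrArg (fun x : {l : List G.E // l.Nodup} => x.1) hab)

noncomputable instance instFintypePreWords (S : Finset G.V) (y : G.V) :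
    Fintype {l : List G.E // G.IsPreWord S y l} :=
  have := G.finite_preWords S y
  Fintype.ofFinite _

/-- A path to `y` is an edge, or a path to the tail of an edge followed by that edge. -/
def snocMap (S : Finset G.V) (y : G.V) :
    {e : G.E // G.h e = y ∧ G.t e ∉ S} ⊕
      (Σ e : {e : G.E // G.h e = y ∧ G.t e ∈ S}, {l : List G.E // G.IsPreWord S (G.t e.1) l}) →
    {l : List G.E // G.IsPreWord S y l}
  | .inl e => ⟨[e.1], by simp, by simp, by simpa using e.2.2, by simpa using e.2.1⟩
  | .inr ⟨e, l⟩ => ⟨l.1 ++ [e.1], by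
      obtain ⟨hc, hl, h1, h2⟩ := l.2
      refine ⟨?_, by simp, ?_, by simpa using e.2.1⟩
      · rw [List.isChain_append]
        refine ⟨hc, by simp, ?_⟩
        intro a ha b hb
        rw [List.getLast?_eq_some_getLast hl, Option.mem_some_iff] at ha
        rw [List.head?_cons, Option.mem_some_iff] at hb
        subst ha hb
        exact ⟨h2, by rw [h2]; exact e.2.2⟩
      · rwa [List.head_append_of_ne_nil hl]⟩

theorem snocMap_bijective (S : Finset G.V) (y : G.V) : Function.Bijective (G.snocMap S y) := by
  constructor
  · rintro (⟨e, he⟩ | ⟨⟨e, he⟩, ⟨l, hl⟩⟩) (⟨f, hf⟩ | ⟨⟨f, hf⟩, ⟨m, hm⟩⟩) h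
    · have h' : [e] = [f] := congrArg Subtype.val h
      obtain rfl : e = f := by simpa using h'
      rfl
    · have h' : [e] = m ++ [f] := congrArg Subtype.val h
      have := congrArg List.length h'
      simp at this
      exact absurd this hm.2.1
    · have h' : l ++ [e] = [f] := congrArg Subtype.val h
      have := congrArg List.length h'
      simp at this
      exact absurd this hl.2.1
    · have h' : l ++ [e] = m ++ [f] := congrArg Subtype.val h
      obtain ⟨h1, h2⟩ := List.append_inj' h' rfl
      obtain rfl : e = f := by simpa using h2
      subst h1
      rfl
  · rintro ⟨l, hc, hl, h1, h2⟩
    rcases List.eq_nil_or_concat' l with rfl | ⟨m, e, rfl⟩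
    · exact absurd rfl hl
    by_cases hm : m = []
    · subst hm
      exact ⟨.inl ⟨e, by simpa using h2, by simpa using h1⟩, rfl⟩
    · rw [List.isChain_append] at hc
      have h3 := hc.2.2 _ (List.getLast?_eq_some_getLast hm) e (by simp)
      rw [List.head_append_of_ne_nil hm] at h1
      refine ⟨.inr ⟨⟨e, by simpa using h2, h3.1 ▸ h3.2⟩, ⟨m, hc.1, hm, h1, h3.1⟩⟩, rfl⟩

open scoped Classical in
/-- A function `f` with `f(y) = ∑ f(t e) g(e)` at all non-roots satisfies the same recursion along
the words, if only non-roots are projected out. -/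
theorem sum_preWords {K : Type w} [CommRing K] {S : Finset G.V} (hS : ∀ z ∈ S, ¬ G.IsRoot z)
    (f : G.V → K) (g : G.E → K)
    (hf : ∀ y, ¬ G.IsRoot y → f y = ∑ e : G.E with G.h e = y, f (G.t e) * g e) (y : G.V)
    (hy : ¬ G.IsRoot y) :
    ∑ l : {l : List G.E // G.IsPreWord S y l}, f (G.t (l.1.head l.2.2.choose)) * (l.1.map g).prod
      = f y := by
  induction y using G.isParent_wf.induction with
  | _ y ih =>
  rw [← (G.snocMap_bijective S y).sum_comp, Fintype.sum_sum_type, Fintype.sum_sigma, hf y hy]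
  have h1 : ∀ e : {e : G.E // G.h e = y ∧ G.t e ∈ S},
      ∑ l : {l : List G.E // G.IsPreWord S (G.t e.1) l},
        f (G.t ((G.snocMap S y (.inr ⟨e, l⟩)).1.head (G.snocMap S y (.inr ⟨e, l⟩)).2.2.choose)) *
          ((G.snocMap S y (.inr ⟨e, l⟩)).1.map g).prod = f (G.t e.1) * g e.1 := by
    intro e
    rw [← ih (G.t e.1) ⟨e.1, rfl, e.2.1⟩ (hS _ e.2.2), Finset.sum_mul]
    refine Finset.sum_congr rfl fun l _ => ?_
    have hl : l.1 ≠ [] := l.2.2.choose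
    simp only [snocMap, List.head_append_of_ne_nil hl, List.map_append, List.prod_append,
      List.map_cons, List.map_nil, List.prod_singleton, mul_assoc]
  rw [Finset.sum_congr rfl fun e _ => h1 e]
  have h2 : ∀ e : {e : G.E // G.h e = y ∧ G.t e ∉ S},
      f (G.t ((G.snocMap S y (.inl e)).1.head (G.snocMap S y (.inl e)).2.2.choose)) *
        ((G.snocMap S y (.inl e)).1.map g).prod = f (G.t e.1) * g e.1 := by
    intro e
    simp [snocMap]
  rw [Finset.sum_congr rfl fun e _ => h2 e]
  rw [← Finset.sum_subtype (Finset.univ.filter fun e => G.h e = y ∧ G.t e ∉ S) (by simp)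
      (fun e => f (G.t e) * g e),
    ← Finset.sum_subtype (Finset.univ.filter fun e => G.h e = y ∧ G.t e ∈ S) (by simp)
      (fun e => f (G.t e) * g e), ← Finset.filter_filter, ← Finset.filter_filter, add_comm,
    Finset.sum_filter_add_sum_filter_not]

/-- `q` is normalized: the weights of the edges into any non-root sum to `1`. -/
def IsNormalized {K : Type u} [CommRing K] (q : G.E → K) : Prop :=
  ∀ y, ¬ G.IsRoot y → ∑ x, G.pairWeight q x y = 1

/-- A DAMG automorphism. -/
structure Aut where
  onV : G.V ≃ G.V
  onE : G.E ≃ G.E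
  t_map : ∀ e, G.t (onE e) = onV (G.t e)
  h_map : ∀ e, G.h (onE e) = onV (G.h e)

variable {G}

theorem Aut.isRoot_map (α : G.Aut) {r : G.V} (hr : G.IsRoot r) : G.IsRoot (α.onV r) := by
  rintro y ⟨e, -, he⟩
  refine hr (G.t (α.onE.symm e)) ⟨α.onE.symm e, rfl, ?_⟩
  apply α.onV.injective
  rw [← α.h_map, Equiv.apply_symm_apply, he]

/-- The root `α(r)`. -/
def Aut.onRoot (α : G.Aut) (r : G.Root) : G.Root := ⟨α.onV r.1, α.isRoot_map r.2⟩

end DAMG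

/-- A projectable directed acyclic multigraph (`K`-PDAMG): a DAMG with an edge weight function
that is normalized at every non-root. -/
structure PDAMG (K : Type u) [CommRing K] extends DAMG.{v} where
  q : E → K
  normalized : toDAMG.IsNormalized q

/-- The Shapley value of a `K`-PDAMG: the synergy function of `v`, projected onto the set of
roots. -/
noncomputable def PDAMG.shapley {K : Type u} [CommRing K] (P : PDAMG.{u, v} K) {A : Type w}
    [AddCommGroup A] [Module K A] (v : P.V → A) (r : P.Root) : A :=
  open scoped Classical in
  P.projSynergy P.q (Finset.univ.filter fun z => ¬ P.IsRoot z) (P.synergy v)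
    ⟨r.1, by simpa using r.2⟩

/-- An edge and root weighted DAMG over `R` (`R`-DAMG). -/
structure RDAMG (R : Type u) [CommRing R] extends DAMG.{v} where
  ς : E → R
  τ : toDAMG.Root → R

namespace RDAMG

variable {R : Type u} [CommRing R] (G : RDAMG.{u, v} R)

/-- The extension of the root weights to all vertices:
`τ(y) = ∑_{z ∈ Pa(y)} τ(z) ς(z,y)` for a non-root `y`. -/
noncomputable def strength : G.V → R :=
  open scoped Classical in
  G.isParent_wf.fix fun y s =>
    if hy : G.IsRoot y then G.τ ⟨y, hy⟩
    else ∑ z : {z : G.V // G.IsParent z y}, s z.1 z.2 * G.pairWeight G.ς z.1 y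

/-- The multiplicative set generated by the denominators of the induced projection weights, that
is, by the strengths of the heads of edges (the non-roots). -/
def denominators : Submonoid R := Submonoid.closure (Set.range fun e : G.E => G.strength (G.h e))

/-- The localization of `R` in which the fractions are formed. -/
abbrev Loc : Type u := Localization G.denominators

/-- The fraction `a / b` in the localization; it is only used where `b` becomes invertible, so
that `Ring.inverse` is the inverse. -/
noncomputable def frac (a b : R) : G.Loc :=
  algebraMap R G.Loc a * Ring.inverse (algebraMap R G.Loc b)

/-- The induced projection weight of an edge, as an element of the localization. -/
noncomputable def qLoc (e : G.E) : G.Loc :=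
  G.frac (G.strength (G.t e)) (G.strength (G.h e)) * algebraMap R G.Loc (G.ς e)

/-- `R_q`: the `R`-algebra generated by the induced projection weights. -/
noncomputable def subalgebraRq : Subalgebra R G.Loc := Algebra.adjoin R (Set.range G.qLoc)

abbrev Rq : Type u := G.subalgebraRq

/-- The induced projection weight function, with values in `R_q`. -/
noncomputable def q (e : G.E) : G.Rq := ⟨G.qLoc e, Algebra.subset_adjoin ⟨e, rfl⟩⟩

/-- The ratio `τ(x) / τ(y)`; the ratio of the strength of a vertex to itself is `1` (also at a root
whose weight is not invertible).  It is only used multiplied by `σ(x,y)`, which is `0` if `y ≠ x`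
is a root, and otherwise `τ(y)` is invertible in the localization. -/
noncomputable def ratio (x y : G.V) : G.Loc :=
  open scoped Classical in if x = y then 1 else G.frac (G.strength x) (G.strength y)

theorem strength_root {y : G.V} (hy : G.IsRoot y) : G.strength y = G.τ ⟨y, hy⟩ := by
  rw [strength, WellFounded.fix_eq, dif_pos hy]

theorem strength_nonroot {y : G.V} (hy : ¬ G.IsRoot y) :
    G.strength y =
      open scoped Classical in ∑ e : G.E with G.h e = y, G.strength (G.t e) * G.ς e := by
  rw [← G.sum_parents G.strength G.ς y]
  conv_lhs => rw [strength, WellFounded.fix_eq, dif_neg hy]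
  rfl

theorem isUnit_strength (e : G.E) : IsUnit (algebraMap R G.Loc (G.strength (G.h e))) :=
  IsLocalization.map_units G.Loc
    (⟨_, Submonoid.subset_closure ⟨e, rfl⟩⟩ : G.denominators)

theorem isUnit_strength_nonroot {y : G.V} (hy : ¬ G.IsRoot y) :
    IsUnit (algebraMap R G.Loc (G.strength y)) := by
  simp only [DAMG.IsRoot, not_forall, not_not] at hy
  obtain ⟨z, e, -, rfl⟩ := hy
  exact G.isUnit_strength e

theorem ratio_mem (x y : G.V) :
    G.ratio x y * algebraMap R G.Loc (G.totalWeight G.ς x y) ∈ G.subalgebraRq := by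
  classical
  induction y using G.isParent_wf.induction with
  | _ y ih =>
  by_cases hxy : x = y
  · subst hxy
    rw [ratio, if_pos rfl, one_mul]
    exact Subalgebra.algebraMap_mem _ _
  rw [DAMG.totalWeight_eq]
  by_cases h1 : G.IsAnc x y
  swap
  · rw [if_pos h1, map_zero, mul_zero]
    exact Subalgebra.zero_mem _
  rw [if_neg (not_not.2 h1), if_neg (Ne.symm hxy)]
  rw [map_sum, Finset.mul_sum]
  refine Subalgebra.sum_mem _ fun e he => ?_
  obtain rfl : G.h e = y := by simpa using he
  have h3 := Subalgebra.mul_mem _ (ih (G.t e) ⟨e, rfl, rfl⟩) (G.q e).2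
  convert h3 using 1
  simp only [q, qLoc]
  rw [ratio, if_neg hxy, map_mul]
  by_cases hxt : x = G.t e
  · rw [← hxt, ratio, if_pos rfl]; ring
  by_cases hr : G.IsRoot (G.t e)
  · rw [G.totalWeight_root G.ς hxt hr]; simp
  · rw [ratio, if_neg hxt, frac, frac, frac]
    have h4 := Ring.inverse_mul_cancel _ (G.isUnit_strength_nonroot hr)
    linear_combination (-algebraMap R G.Loc (G.strength x) *
      Ring.inverse (algebraMap R G.Loc (G.strength (G.h e))) *
      algebraMap R G.Loc (G.totalWeight G.ς x (G.t e)) * algebraMap R G.Loc (G.ς e)) * h4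

/-- The coefficient `(τ(x) / τ(y)) σ(x,y)`, as an element of `R_q`. -/
noncomputable def coef (x y : G.V) : G.Rq :=
  ⟨G.ratio x y * algebraMap R G.Loc (G.totalWeight G.ς x y), G.ratio_mem x y⟩

theorem q_normalized : G.toDAMG.IsNormalized G.q := by
  classical
  intro y hy
  rw [DAMG.sum_pairWeight]
  apply Subtype.ext
  have h1 := Ring.mul_inverse_cancel _ (G.isUnit_strength_nonroot hy)
  have h2 : ((∑ e : G.E with G.h e = y, G.q e : G.Rq) : G.Loc)
      = ∑ e : G.E with G.h e = y, (G.q e : G.Loc) := map_sum G.subalgebraRq.val _ _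
  have h3 := congrArg (algebraMap R G.Loc) (G.strength_nonroot hy)
  rw [map_sum] at h3
  refine h2.trans (Eq.trans ?_ h1)
  nth_rw 1 [h3]
  rw [Finset.sum_mul]
  refine Finset.sum_congr rfl fun e he => ?_
  obtain rfl : G.h e = y := by simpa using he
  simp only [q, qLoc, frac, map_mul]
  ring

/-- The `R_q`-PDAMG of the induced projection weights. -/
noncomputable def inducedPDAMG : PDAMG.{u, v} G.Rq where
  toDAMG := G.toDAMG
  q := G.q
  normalized := G.q_normalized

/-- The projection of an `R`-DAMG: the weight of a word is the product of the weights of its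
letters, and the root weights are the strengths. -/
noncomputable def proj (S : Finset G.V) : RDAMG.{u, v} R where
  toDAMG := G.toDAMG.proj S
  ς l := (l.1.map G.ς).prod
  τ r := G.strength r.1.1

theorem strength_proj {S : Finset G.V} (hS : ∀ z ∈ S, ¬ G.IsRoot z) (x : (G.proj S).V) :
    (G.proj S).strength x = G.strength x.1 := by
  classical
  induction x using (G.proj S).isParent_wf.induction with
  | _ x ih =>
  by_cases hx : (G.proj S).IsRoot x
  · rw [(G.proj S).strength_root hx]; rfl
  have hx' : ¬ G.IsRoot x.1 := fun h => hx (G.isRoot_proj x h)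
  rw [(G.proj S).strength_nonroot hx,
    ← G.sum_preWords hS G.strength G.ς (fun y hy => G.strength_nonroot hy) x.1 hx']
  rw [Finset.sum_subtype (p := fun l => (G.proj S).h l = x) _ (by simp)]
  refine Fintype.sum_bijective (fun l => ⟨l.1.1, l.1.2.1, l.1.2.2.choose,
    l.1.2.2.choose_spec.1, congrArg Subtype.val l.2⟩) ⟨?_, ?_⟩ _ _ ?_
  · intro a b hab
    have h : a.1.1 = b.1.1 := by injection hab
    exact Subtype.ext (Subtype.ext h)
  · rintro ⟨l, hc, hl, h1, h2⟩
    exact ⟨⟨⟨l, hc, hl, h1, by rw [h2]; exact x.2⟩, Subtype.ext h2⟩, rfl⟩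
  · rintro ⟨l, rfl⟩
    rw [ih _ ⟨l, rfl, rfl⟩]
    rfl

theorem prod_qLoc {S : Finset G.V} (l : List G.E)
    (h : l.IsChain (fun e f => G.h e = G.t f ∧ G.h e ∈ S)) (hl : l ≠ []) :
    (l.map G.qLoc).prod = G.frac (G.strength (G.t (l.head hl))) (G.strength (G.h (l.getLast hl))) *
      algebraMap R G.Loc (l.map G.ς).prod := by
  induction l with
  | nil => exact absurd rfl hl
  | cons e l ih =>
    cases l with
    | nil => simp [qLoc]
    | cons f l =>
      rw [List.isChain_cons_cons] at h
      have hfl : f :: l ≠ [] := List.cons_ne_nil f l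
      have h5 : ((e :: f :: l).map G.ς).prod = G.ς e * ((f :: l).map G.ς).prod := rfl
      rw [List.map_cons, List.prod_cons, ih h.2 hfl, List.getLast_cons hfl, h5, map_mul]
      simp only [List.head_cons, qLoc, frac, ← h.1.1]
      have h4 := Ring.inverse_mul_cancel _ (G.isUnit_strength e)
      linear_combination (algebraMap R G.Loc (G.strength (G.t e)) *
        Ring.inverse (algebraMap R G.Loc (G.strength (G.h ((f :: l).getLast hfl)))) *
        algebraMap R G.Loc (G.ς e) * algebraMap R G.Loc ((f :: l).map G.ς).prod) * h4

theorem isUnit_denominators_proj {S : Finset G.V} (hS : ∀ z ∈ S, ¬ G.IsRoot z)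
    (a : (G.proj S).denominators) : IsUnit (Algebra.ofId R G.Loc a) := by
  have h1 : (G.proj S).denominators ≤
      (IsUnit.submonoid G.Loc).comap (algebraMap R G.Loc : R →* G.Loc) := by
    refine Submonoid.closure_le.2 ?_
    rintro _ ⟨l, rfl⟩
    change IsUnit (algebraMap R G.Loc ((G.proj S).strength ((G.proj S).h l)))
    rw [G.strength_proj hS]
    exact G.isUnit_strength (l.1.getLast l.2.2.choose)
  exact h1 a.2

/-- The canonical `R`-algebra map between the localizations, for `S` a set of non-roots. -/
noncomputable def projLocHom (S : Finset G.V) (hS : ∀ z ∈ S, ¬ G.IsRoot z) :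
    (G.proj S).Loc →ₐ[R] G.Loc :=
  IsLocalization.liftAlgHom (M := (G.proj S).denominators) (f := Algebra.ofId R G.Loc)
    (G.isUnit_denominators_proj hS)

theorem projLocHom_mem (S : Finset G.V) (hS : ∀ z ∈ S, ¬ G.IsRoot z) (a : (G.proj S).Rq) :
    G.projLocHom S hS a.1 ∈ G.subalgebraRq := by
  have h1 : (G.proj S).subalgebraRq ≤ G.subalgebraRq.comap (G.projLocHom S hS) := by
    refine Algebra.adjoin_le ?_
    rintro _ ⟨l, rfl⟩
    have h2 : G.projLocHom S hS ((G.proj S).qLoc l) = (l.1.map G.qLoc).prod := by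
      rw [G.prod_qLoc l.1 l.2.1 l.2.2.choose, qLoc, frac, map_mul, map_mul, AlgHom.commutes,
        AlgHom.commutes, frac, G.strength_proj hS, G.strength_proj hS]
      congr 2
      have hu := (G.proj S).isUnit_strength l
      rw [G.strength_proj hS] at hu
      have h3 := congrArg (G.projLocHom S hS) (Ring.inverse_mul_cancel _ hu)
      rw [map_mul, AlgHom.commutes, map_one] at h3
      have h4 := Ring.mul_inverse_cancel _ (G.isUnit_strength (l.1.getLast l.2.2.choose))
      exact left_inv_eq_right_inv h3 h4
    change G.projLocHom S hS ((G.proj S).qLoc l) ∈ G.subalgebraRq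
    rw [h2]
    refine Subalgebra.list_prod_mem _ ?_
    simp only [List.mem_map]
    rintro _ ⟨e, -, rfl⟩
    exact (G.q e).2
  exact h1 a.2

/-- The canonical (and only) `R`-algebra map from the ring `R_q` of the projection of `G` onto the
complement of a set of non-roots to the ring `R_q` of `G`. -/
noncomputable def projHom (S : Finset G.V) (hS : ∀ z ∈ S, ¬ G.IsRoot z) :
    (G.proj S).Rq →ₐ[R] G.Rq :=
  ((G.projLocHom S hS).comp (G.proj S).subalgebraRq.val).codRestrict G.subalgebraRq
    (G.projLocHom_mem S hS)

/-- An `R_q`-module of `G`, as an `R_q`-module of the projection, along the canonical map. -/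
@[reducible] noncomputable def projModule (S : Finset G.V) (hS : ∀ z ∈ S, ¬ G.IsRoot z)
    (A : Type w) [AddCommGroup A] [Module G.Rq A] : Module (G.proj S).Rq A :=
  Module.compHom A (G.projHom S hS).toRingHom

/-- An `R`-DAMG automorphism. -/
structure Aut extends G.toDAMG.Aut where
  ς_map : ∀ e, G.ς (onE e) = G.ς e
  τ_map : ∀ r : G.Root, G.τ (toAut.onRoot r) = G.τ r

end RDAMG

/-- An assignment rule: to every `R`-DAMG `G`, every `R_q`-module `A`, every value function
`v : V → A` and every root `r` it assigns an element of `A`. -/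
abbrev Rule (R : Type u) [CommRing R] : Type (max (u + 1) (v + 1)) :=
  ∀ (G : RDAMG.{u, v} R) (A : Type u) [AddCommGroup A] [Module G.Rq A], (G.V → A) → G.Root → A

namespace Rule

variable {R : Type u} [CommRing R] (Sh : Rule.{u, v} R)

def ALinearity : Prop :=
  ∀ (G : RDAMG.{u, v} R) (A : Type u) [AddCommGroup A] [Module G.Rq A]
    (I : Type) [Fintype I] (a : I → A) (v : I → G.V → G.Rq) (r : G.Root),
    Sh G A (fun x => ∑ i, v i x • a i) r = ∑ i, Sh G G.Rq (v i) r • a i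

def WeakElements : Prop :=
  ∀ (G : RDAMG.{u, v} R) (A : Type u) [AddCommGroup A] [Module G.Rq A] (v : G.V → A)
    (W : Finset G.V) (hW : ∀ z ∈ W, ¬ G.IsRoot z), (∀ z ∈ W, G.IsWeak v z) → ∀ r : G.Root,
    letI := G.projModule W hW A
    Sh G A v r = Sh (G.proj W) A (G.restrict W v) (G.projRoot W hW r)

def FlatHierarchy : Prop :=
  open scoped Classical in
  ∀ G : RDAMG.{u, v} R, G.IsFlat → ∀ (y : G.V) (r : G.Root),
    (G.IsRoot y → Sh G G.Rq (G.unanimity G.Rq y) r = if r.1 = y then 1 else 0) ∧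
    (¬ G.IsRoot y → (Sh G G.Rq (G.unanimity G.Rq y) r : G.Loc) =
      G.frac (G.τ r * G.pairWeight G.ς r.1 y) (∑ u : G.Root, G.τ u * G.pairWeight G.ς u.1 y))

/-- `Sh_r(v) = ∑_y (τ(r) / τ(y)) σ(r,y) v'_G(y)`. -/
def ExplicitFormula : Prop :=
  ∀ (G : RDAMG.{u, v} R) (A : Type u) [AddCommGroup A] [Module G.Rq A] (v : G.V → A)
    (r : G.Root), Sh G A v r = ∑ y, G.coef r.1 y • G.synergy v y

def InducedProjectionWeights : Prop :=
  ∀ (G : RDAMG.{u, v} R) (A : Type u) [AddCommGroup A] [Module G.Rq A] (v : G.V → A)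
    (r : G.Root), Sh G A v r = G.inducedPDAMG.shapley v r

def RLinearity : Prop :=
  ∀ (G : RDAMG.{u, v} R) (A : Type u) [AddCommGroup A] [Module G.Rq A] (v₁ v₂ : G.V → A)
    (c₁ c₂ : G.Rq) (r : G.Root),
    Sh G A (fun x => c₁ • v₁ x + c₂ • v₂ x) r = c₁ • Sh G A v₁ r + c₂ • Sh G A v₂ r

def Efficiency : Prop :=
  open scoped Classical in
  ∀ (G : RDAMG.{u, v} R) (A : Type u) [AddCommGroup A] [Module G.Rq A] (v : G.V → A),
    ∑ r : G.Root, Sh G A v r = ∑ x, G.synergy v x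

def NullRoot : Prop :=
  ∀ (G : RDAMG.{u, v} R) (A : Type u) [AddCommGroup A] [Module G.Rq A] (v : G.V → A)
    (r : G.Root), G.IsNull v r.1 → Sh G A v r = 0

def Projection : Prop :=
  ∀ (G : RDAMG.{u, v} R) (A : Type u) [AddCommGroup A] [Module G.Rq A] (v : G.V → A)
    (S : Finset G.V) (hS : ∀ z ∈ S, ¬ G.IsRoot z) (r : G.Root),
    letI := G.projModule S hS A
    Sh G A v r = Sh (G.proj S) A (G.projValue G.q S v) (G.projRoot S hS r)

def Symmetry : Prop :=
  ∀ (G : RDAMG.{u, v} R) (A : Type u) [AddCommGroup A] [Module G.Rq A] (v : G.V → A)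
    (α : G.Aut) (r : G.Root),
    Sh G A v (α.onRoot r) = Sh G A (fun x => v (α.onV x)) r ∧
    ((∀ y, G.IsAnc r.1 y → G.synergy v (α.onV y) = G.synergy v y) →
      Sh G A v (α.onRoot r) = Sh G A v r)

end Rule

/-- The rule defined by the explicit formula. -/
noncomputable def explicitRule (R : Type u) [CommRing R] : Rule.{u, v} R :=
  fun G _ _ _ v r => ∑ y, G.coef r.1 y • G.synergy v y

/-! Call a function on the vertices harmonic for edge weights `a` if at every non-root it equals the
sum, over incoming edges, of its value at the tail times the weight. By acyclicity a harmonic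
function is determined by its root values (`IsHarmonic.ext`), and almost every identity below
compares two harmonic functions on the roots. For the weights `ς` the harmonic functions in play are
the strength and, for a root `r`, the path weight `σ(r,·)`; for the induced weights `q` they are the
coefficient `c_r(y) = (τ(r)/τ(y)) σ(r,y)` and, by normalization, the constant `1`.

Existence: the explicit rule pairs `c_r` with the synergy function. Projecting out a non-root `z`
redistributes `w(z)` to its parents, and harmonicity of `c_r` is exactly what keeps `∑ c_r(x) w(x)`
unchanged (`DAMG.sum_projSynergy`). This gives the projection property and, when all non-roots are
projected out, the agreement with the Shapley value for `q`. The coefficients survive projection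
(`projHom_coef`), since harmonic functions restrict to harmonic functions. Efficiency says `∑_r c_r
= 1`, and symmetry is invariance of `c_r` under automorphisms.

Uniqueness: `v` is the combination of the unanimity functions `ζ_y` with coefficients `v'_G(y)`, so
linearity leaves only `ζ_y`. Every vertex except `y` is weak for `ζ_y`; removing the non-roots other
than `y` leaves a flat hierarchy, where the value is prescribed and equals the coefficient of the
projected graph, hence `c_r(y)`. -/

namespace DAMG

/-! ### Harmonic functions -/

variable (G : DAMG.{v})

open scoped Classical in
/-- `f` satisfies `f(y) = ∑ f(t e) a(e)`, the sum over all edges into `y`, at every non-root `y`. -/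
def IsHarmonic {K : Type w} [CommRing K] (a : G.E → K) (f : G.V → K) : Prop :=
  ∀ y, ¬ G.IsRoot y → f y = ∑ e : G.E with G.h e = y, f (G.t e) * a e

variable {G}

theorem IsHarmonic.ext {K : Type w} [CommRing K] {a : G.E → K} {f g : G.V → K}
    (hf : G.IsHarmonic a f) (hg : G.IsHarmonic a g) (h : ∀ y, G.IsRoot y → f y = g y) : f = g := by
  classical
  funext y
  induction y using G.isParent_wf.induction with
  | _ y ih =>
  by_cases hy : G.IsRoot y
  · exact h y hy
  rw [hf y hy, hg y hy]
  refine Finset.sum_congr rfl fun e he => ?_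
  rw [ih (G.t e) ⟨e, rfl, by simpa using he⟩]

theorem IsHarmonic.sum {K : Type w} [CommRing K] {a : G.E → K} {ι : Type*} (s : Finset ι)
    {f : ι → G.V → K} (c : ι → K) (hf : ∀ i ∈ s, G.IsHarmonic a (f i)) :
    G.IsHarmonic a (fun y => ∑ i ∈ s, c i * f i y) := by
  classical
  intro y hy
  simp only [Finset.sum_mul]
  rw [Finset.sum_comm]
  refine Finset.sum_congr rfl fun i hi => ?_
  rw [hf i hi y hy, Finset.mul_sum]
  exact Finset.sum_congr rfl fun e _ => (mul_assoc _ _ _).symm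

/-- Groups the incoming edges by tail. Successive projection is defined through pairwise weights, so
this form is the one used there. -/
theorem isHarmonic_iff_pairWeight {K : Type w} [CommRing K] {a : G.E → K} {f : G.V → K} :
    G.IsHarmonic a f ↔ ∀ y, ¬ G.IsRoot y → f y = ∑ x, f x * G.pairWeight a x y := by
  classical
  refine forall_congr' fun y => imp_congr_right fun _ => ?_
  suffices h : ∑ e : G.E with G.h e = y, f (G.t e) * a e = ∑ x, f x * G.pairWeight a x y by
    rw [← h]
  rw [← Finset.sum_fiberwise (Finset.univ.filter fun e : G.E => G.h e = y) G.t]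
  refine Finset.sum_congr rfl fun z _ => ?_
  rw [pairWeight, Finset.mul_sum, Finset.filter_filter]
  refine Finset.sum_congr (by ext e; simp [and_comm]) fun e he => ?_
  simp only [Finset.mem_filter] at he
  rw [he.2.1]

theorem IsNormalized.isHarmonic_one {K : Type w} [CommRing K] {a : G.E → K}
    (h : G.IsNormalized a) : G.IsHarmonic a (fun _ => 1) :=
  isHarmonic_iff_pairWeight.2 fun y hy => by simpa using (h y hy).symm

/-! ### Path weights as harmonic functions -/

variable (G)

theorem isAnc_refl (x : G.V) : G.IsAnc x x := .refl

theorem not_isAnc_root {x y : G.V} (hxy : x ≠ y) (hy : G.IsRoot y) : ¬ G.IsAnc x y := by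
  intro h
  rcases Relation.ReflTransGen.cases_tail h with h | ⟨z, -, h⟩
  · exact hxy h.symm
  · exact hy z h

theorem totalWeight_self {K : Type u} [CommRing K] (f : G.E → K) (x : G.V) :
    G.totalWeight f x x = 1 := by
  rw [totalWeight_eq, if_neg (not_not.2 (G.isAnc_refl x)), if_pos rfl]

theorem totalWeight_of_not_isAnc {K : Type u} [CommRing K] (f : G.E → K) {x y : G.V}
    (h : ¬ G.IsAnc x y) : G.totalWeight f x y = 0 := by
  rw [totalWeight_eq, if_pos h]

/-- The exceptional value `1` at `r` does no harm because `r` is a root, where harmonicity demands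
nothing. If `r` is not an ancestor of `y`, it is not an ancestor of any parent of `y` either, and
both sides vanish. -/
theorem isHarmonic_totalWeight {K : Type u} [CommRing K] (f : G.E → K) {r : G.V}
    (hr : G.IsRoot r) : G.IsHarmonic f (G.totalWeight f r) := by
  classical
  intro y hy
  have hyr : y ≠ r := fun h => hy (h ▸ hr)
  by_cases h : G.IsAnc r y
  · rw [totalWeight_eq, if_neg (not_not.2 h), if_neg hyr]
  · rw [G.totalWeight_of_not_isAnc f h, Finset.sum_eq_zero]
    intro e he
    obtain rfl : G.h e = y := by simpa using he
    rw [G.totalWeight_of_not_isAnc f fun h' => h (h'.tail ⟨e, rfl, rfl⟩), zero_mul]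

theorem totalWeight_of_isFlat {K : Type u} [CommRing K] (f : G.E → K) (hG : G.IsFlat) {r y : G.V}
    (hr : G.IsRoot r) (hy : ¬ G.IsRoot y) : G.totalWeight f r y = G.pairWeight f r y := by
  classical
  rw [isHarmonic_iff_pairWeight.1 (G.isHarmonic_totalWeight f hr) y hy,
    Finset.sum_eq_single_of_mem r (Finset.mem_univ r), totalWeight_self, one_mul]
  intro x _ hx
  -- A root other than `r` is not reached from `r`; a leaf has no edge to `y`.
  rcases hG x with h | h
  · rw [G.totalWeight_root f hx.symm h, zero_mul]
  · rw [pairWeight, Finset.filter_false_of_mem, Finset.sum_empty, mul_zero]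
    exact fun e _ he => h y ⟨e, he⟩

/-- Acyclicity expressed through pairwise weights alone, a form that persists when vertices are
projected out. -/
theorem exists_strictOrder_pairWeight {K : Type u} [CommRing K] (f : G.E → K) :
    ∃ lt : G.V → G.V → Prop, IsStrictOrder G.V lt ∧
      ∀ x y, ¬ lt x y → G.pairWeight f x y = 0 := by
  classical
  obtain ⟨lt, hlt, he⟩ := G.exists_topologicalOrder
  refine ⟨lt, inferInstance, fun x y hxy => ?_⟩
  rw [pairWeight, Finset.filter_false_of_mem, Finset.sum_empty]
  rintro e - ⟨rfl, rfl⟩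
  exact hxy (he e)

/-! ### Synergy functions -/

open scoped Classical in
theorem sum_synergy {A : Type u} [AddCommGroup A] (v : G.V → A) (x : G.V) :
    ∑ y with G.IsAnc y x, G.synergy v y = v x := by
  have h : G.synergy v x = v x - ∑ y with G.IsAnc y x ∧ y ≠ x, G.synergy v y := by
    rw [Finset.sum_subtype (p := fun y => G.IsAnc y x ∧ y ≠ x) _ (by simp)]
    conv_lhs => rw [synergy, WellFounded.fix_eq]
    rfl
  rw [← Finset.sum_erase_add _ _ (show x ∈ Finset.univ.filter fun y => G.IsAnc y x by
    simpa using G.isAnc_refl x)]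
  rw [show (Finset.univ.filter fun y => G.IsAnc y x).erase x
    = Finset.univ.filter fun y => G.IsAnc y x ∧ y ≠ x by ext; simp [and_comm], h]
  abel

-- Möbius inversion: the sum at `x` contains `w x` with coefficient one, so induction over strict
-- ancestors determines `w`. Synergy functions are identified below by checking their sums over
-- ancestors.
open scoped Classical in
theorem eq_synergy {A : Type u} [AddCommGroup A] {v w : G.V → A}
    (h : ∀ x, ∑ y with G.IsAnc y x, w y = v x) : w = G.synergy v := by
  funext x
  induction x using G.strictAnc_wf.induction with
  | _ x ih =>
  have hx : x ∈ Finset.univ.filter fun y => G.IsAnc y x := by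
    simpa using G.isAnc_refl x
  have h1 := (h x).trans (G.sum_synergy v x).symm
  rw [← Finset.sum_erase_add _ _ hx, ← Finset.sum_erase_add _ _ hx] at h1
  rw [Finset.sum_congr rfl fun y hy => ih y (by simpa [and_comm] using hy)] at h1
  exact add_left_cancel h1

theorem synergy_sum_smul {K : Type w} [CommRing K] {A : Type u} [AddCommGroup A] [Module K A]
    {ι : Type*} (s : Finset ι) (c : ι → K) (v : ι → G.V → A) :
    G.synergy (fun x => ∑ i ∈ s, c i • v i x) = fun x => ∑ i ∈ s, c i • G.synergy (v i) x := by
  classical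
  refine (G.eq_synergy fun x => ?_).symm
  rw [Finset.sum_comm]
  refine Finset.sum_congr rfl fun i _ => ?_
  rw [← Finset.smul_sum, sum_synergy]

theorem synergy_sum_smul' {K : Type u} [CommRing K] {A : Type w} [AddCommGroup A] [Module K A]
    {ι : Type*} (s : Finset ι) (a : ι → A) (v : ι → G.V → K) :
    G.synergy (fun x => ∑ i ∈ s, v i x • a i) = fun x => ∑ i ∈ s, G.synergy (v i) x • a i := by
  classical
  refine (G.eq_synergy fun x => ?_).symm
  rw [Finset.sum_comm]
  refine Finset.sum_congr rfl fun i _ => ?_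
  rw [← Finset.sum_smul, sum_synergy]

open scoped Classical in
theorem synergy_unanimity (K : Type u) [CommRing K] (y : G.V) :
    G.synergy (G.unanimity K y) = Pi.single y 1 := by
  refine (G.eq_synergy fun x => ?_).symm
  simp [unanimity, Pi.single_apply]

-- The unanimity functions are scalar valued and the synergies are vectors, which is precisely the
-- shape to which `A`-linearity applies.
open scoped Classical in
theorem eq_sum_unanimity_smul {K : Type u} [CommRing K] {A : Type w} [AddCommGroup A] [Module K A]
    (v : G.V → A) : v = fun x => ∑ y, G.unanimity K y x • G.synergy v y := by
  funext x
  rw [← G.sum_synergy v x, Finset.sum_filter]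
  refine Finset.sum_congr rfl fun y _ => ?_
  unfold unanimity
  split_ifs <;> simp

theorem isAnc_map_iff {G : DAMG.{v}} (α : G.Aut) {x y : G.V} :
    G.IsAnc (α.onV x) (α.onV y) ↔ G.IsAnc x y := by
  have h : ∀ a b, G.IsParent (α.onV a) (α.onV b) ↔ G.IsParent a b := by
    intro a b
    constructor
    · rintro ⟨e, h1, h2⟩
      refine ⟨α.onE.symm e, α.onV.injective ?_, α.onV.injective ?_⟩
      · rw [← α.t_map, Equiv.apply_symm_apply, h1]
      · rw [← α.h_map, Equiv.apply_symm_apply, h2]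
    · rintro ⟨e, rfl, rfl⟩
      exact ⟨α.onE e, α.t_map e, α.h_map e⟩
  constructor
  · intro hxy
    have := Relation.ReflTransGen.lift (p := G.IsParent) α.onV.symm
      (fun a b hab => (h _ _).1 (by simpa using hab)) _ _ hxy
    simpa [Function.onFun, IsAnc] using this
  · exact fun hxy =>
      Relation.ReflTransGen.lift (p := G.IsParent) α.onV (fun a b hab => (h a b).2 hab) _ _ hxy

theorem synergy_comp_aut {G : DAMG.{v}} (α : G.Aut) {A : Type u} [AddCommGroup A] (v : G.V → A) :
    G.synergy (fun x => v (α.onV x)) = fun x => G.synergy v (α.onV x) := by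
  classical
  refine (G.eq_synergy fun x => ?_).symm
  rw [← G.sum_synergy v (α.onV x), Finset.sum_filter, Finset.sum_filter,
    ← Equiv.sum_comp α.onV fun y => if G.IsAnc y (α.onV x) then G.synergy v y else 0]
  exact Finset.sum_congr rfl fun y _ => if_congr (isAnc_map_iff α).symm rfl rfl

theorem isHarmonic_comp_aut {G : DAMG.{v}} (α : G.Aut) {K : Type w} [CommRing K] {a : G.E → K}
    {f : G.V → K} (ha : ∀ e, a (α.onE e) = a e) (hf : G.IsHarmonic a f) :
    G.IsHarmonic a (fun y => f (α.onV y)) := by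
  classical
  intro y hy
  have hy' : ¬ G.IsRoot (α.onV y) := by
    intro h
    refine hy fun x hx => ?_
    obtain ⟨e, rfl, rfl⟩ := hx
    exact h (α.onV (G.t e)) ⟨α.onE e, α.t_map e, α.h_map e⟩
  change f (α.onV y) = ∑ e : G.E with G.h e = y, f (α.onV (G.t e)) * a e
  rw [hf _ hy', Finset.sum_filter, Finset.sum_filter, ← Equiv.sum_comp α.onE]
  simp only [α.h_map, α.t_map, ha, α.onV.injective.eq_iff]

/-! ### Projected graphs -/

/-- Walking backwards from `y` along edges must leave `S`, since a vertex of `S` is never a root and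
so always has a parent. Hence projection creates no new roots. -/
theorem nonempty_preWord {S : Finset G.V} (hS : ∀ z ∈ S, ¬ G.IsRoot z) (y : G.V)
    (hy : ¬ G.IsRoot y) : Nonempty {l : List G.E // G.IsPreWord S y l} := by
  induction y using G.isParent_wf.induction with
  | _ y ih =>
  simp only [IsRoot, not_forall, not_not] at hy
  obtain ⟨_, e, rfl, rfl⟩ := hy
  by_cases he : G.t e ∈ S
  · obtain ⟨l⟩ := ih (G.t e) ⟨e, rfl, rfl⟩ (hS _ he)
    exact ⟨G.snocMap S _ (.inr ⟨⟨e, rfl, he⟩, l⟩)⟩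
  · exact ⟨G.snocMap S _ (.inl ⟨e, rfl, he⟩)⟩

variable {G} in
/-- A directed path to a vertex outside `S` is an edge of the projected graph. -/
theorem IsPreWord.isWord {S : Finset G.V} {y : G.V} (hy : y ∉ S) {l : List G.E}
    (hl : G.IsPreWord S y l) : G.IsWord S l :=
  ⟨hl.1, hl.2.choose, hl.2.choose_spec.1, by rw [hl.2.choose_spec.2]; exact hy⟩

theorem IsPreWord.isParent {G : DAMG.{v}} {S : Finset G.V} (y : (G.proj S).V) {l : List G.E}
    (hl : G.IsPreWord S y.1 l) :
    (G.proj S).IsParent ⟨G.t (l.head hl.2.choose), hl.2.choose_spec.1⟩ y :=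
  ⟨⟨l, hl.isWord y.2⟩, rfl, Subtype.ext hl.2.choose_spec.2⟩

theorem isRoot_proj_iff {S : Finset G.V} (hS : ∀ z ∈ S, ¬ G.IsRoot z) (x : (G.proj S).V) :
    (G.proj S).IsRoot x ↔ G.IsRoot x.1 := by
  refine ⟨fun h => ?_, G.isRoot_proj x⟩
  by_contra hx
  obtain ⟨l⟩ := G.nonempty_preWord hS x.1 hx
  exact h _ (IsPreWord.isParent x l.2)

theorem isAnc_of_isChain {S : Finset G.V} (l : List G.E)
    (h : l.IsChain (fun e f => G.h e = G.t f ∧ G.h e ∈ S)) (hl : l ≠ []) :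
    G.IsAnc (G.t (l.head hl)) (G.h (l.getLast hl)) := by
  induction l with
  | nil => exact absurd rfl hl
  | cons e l ih =>
    cases l with
    | nil => exact .single ⟨e, rfl, rfl⟩
    | cons f l =>
      rw [List.isChain_cons_cons] at h
      have h2 := ih h.2 (by simp)
      rw [List.getLast_cons (by simp)]
      exact .head ⟨e, rfl, h.1.1⟩ h2

theorem isAnc_proj_iff {S : Finset G.V} (x y : (G.proj S).V) :
    (G.proj S).IsAnc x y ↔ G.IsAnc x.1 y.1 := by
  constructor
  · intro h
    induction h with
    | refl => exact .refl
    | tail _ h ih =>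
      obtain ⟨l, rfl, rfl⟩ := h
      exact ih.trans (G.isAnc_of_isChain l.1 l.2.1 l.2.2.choose)
  · intro h
    -- A path of `G` may pass through `S`. At a vertex of `S` the induction carries an unfinished
    -- word, starting at a vertex outside `S` already reached in the projection.
    have key : ∀ b, G.IsAnc x.1 b →
        (∀ hb : b ∉ S, (G.proj S).IsAnc x ⟨b, hb⟩) ∧
        (b ∈ S → ∃ (l : {l : List G.E // G.IsPreWord S b l}),
          (G.proj S).IsAnc x ⟨G.t (l.1.head l.2.2.choose), l.2.2.choose_spec.1⟩) := by
      intro b hb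
      induction hb with
      | refl => exact ⟨fun _ => .refl, fun h => absurd h x.2⟩
      | tail _ hbc ih =>
        obtain ⟨e, rfl, rfl⟩ := hbc
        have h1 : ∃ (l : {l : List G.E // G.IsPreWord S (G.h e) l}),
            (G.proj S).IsAnc x ⟨G.t (l.1.head l.2.2.choose), l.2.2.choose_spec.1⟩ := by
          by_cases he : G.t e ∈ S
          · obtain ⟨l, hl⟩ := ih.2 he
            refine ⟨G.snocMap S _ (.inr ⟨⟨e, rfl, he⟩, l⟩), ?_⟩
            simpa only [snocMap, List.head_append_of_ne_nil l.2.2.choose] using hl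
          · exact ⟨G.snocMap S _ (.inl ⟨e, rfl, he⟩), ih.1 he⟩
        refine ⟨fun hb => ?_, fun _ => h1⟩
        obtain ⟨l, hl⟩ := h1
        exact hl.tail (IsPreWord.isParent ⟨G.h e, hb⟩ l.2)
    exact (key y.1 h).1 y.2

/-- Harmonic functions restrict to harmonic functions on projected graphs. -/
theorem isHarmonic_proj {K : Type w} [CommRing K] {S : Finset G.V} (hS : ∀ z ∈ S, ¬ G.IsRoot z)
    {a : G.E → K} {f : G.V → K} (hf : G.IsHarmonic a f) :
    (G.proj S).IsHarmonic (fun l => (l.1.map a).prod) (fun x => f x.1) := by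
  classical
  intro x hx
  have hx' : ¬ G.IsRoot x.1 := fun h => hx (G.isRoot_proj x h)
  change f x.1 = _
  rw [← G.sum_preWords hS f a hf x.1 hx']
  rw [Finset.sum_subtype (p := fun l => (G.proj S).h l = x) _ (by simp)]
  symm
  refine Fintype.sum_bijective (fun l => ⟨l.1.1, l.1.2.1, l.1.2.2.choose,
    l.1.2.2.choose_spec.1, congrArg Subtype.val l.2⟩) ⟨?_, ?_⟩ _ _ ?_
  · intro a b hab
    have h : a.1.1 = b.1.1 := by injection hab
    exact Subtype.ext (Subtype.ext h)
  · rintro ⟨l, hl⟩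
    exact ⟨⟨⟨l, IsPreWord.isWord x.2 hl⟩, Subtype.ext hl.2.choose_spec.2⟩, rfl⟩
  · rintro ⟨l, rfl⟩
    rfl

/-- Both sides are harmonic for the word weights on the projected graph and equal the indicator of
`r` on its roots. -/
theorem totalWeight_proj {K : Type u} [CommRing K] {S : Finset G.V}
    (hS : ∀ z ∈ S, ¬ G.IsRoot z) (f : G.E → K) (r : G.Root) (x : (G.proj S).V) :
    (G.proj S).totalWeight (fun l => (l.1.map f).prod) (G.projRoot S hS r).1 x
      = G.totalWeight f r.1 x.1 := by
  refine congrFun (IsHarmonic.ext ((G.proj S).isHarmonic_totalWeight _ (G.projRoot S hS r).2)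
    (G.isHarmonic_proj hS (G.isHarmonic_totalWeight f r.2)) fun y hy => ?_) x
  by_cases h : r.1 = y.1
  · obtain rfl : (G.projRoot S hS r).1 = y := Subtype.ext h
    rw [totalWeight_self]
    exact (G.totalWeight_self f r.1).symm
  · refine ((G.proj S).totalWeight_root _ (fun h' => h (congrArg Subtype.val h')) hy).trans ?_
    exact (G.totalWeight_root f h ((G.isRoot_proj_iff hS y).1 hy)).symm

theorem sum_proj {M : Type*} [AddCommMonoid M] (S : Finset G.V) (f : G.V → M)
    (hf : ∀ z ∈ S, f z = 0) : ∑ x : (G.proj S).V, f x.1 = ∑ x, f x := by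
  classical
  rw [← Finset.sum_subset (Finset.subset_univ (Finset.univ.filter fun x => x ∉ S))
    fun x _ hx => hf x (by simpa using hx)]
  exact (Finset.sum_subtype _ (by simp) f).symm

/-- Projection preserves ancestry and the deleted synergies are zero, so the sums over ancestors are
unchanged. -/
theorem synergy_restrict {A : Type u} [AddCommGroup A] (v : G.V → A) {W : Finset G.V}
    (hW : ∀ z ∈ W, G.IsWeak v z) :
    (G.proj W).synergy (G.restrict W v) = fun x => G.synergy v x.1 := by
  classical
  refine ((G.proj W).eq_synergy fun x => ?_).symm
  rw [restrict, ← G.sum_synergy v x.1, Finset.sum_filter, Finset.sum_filter,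
    ← G.sum_proj W _ fun z hz => by rw [hW z hz, ite_self]]
  simp only [isAnc_proj_iff]

theorem restrict_unanimity (K : Type u) [CommRing K] (S : Finset G.V) (y : (G.proj S).V) :
    G.restrict S (G.unanimity K y.1) = (G.proj S).unanimity K y := by
  funext x
  classical
  exact if_congr (G.isAnc_proj_iff y x).symm rfl rfl

theorem synergy_projValue {K : Type u} [CommRing K] {A : Type w} [AddCommGroup A] [Module K A]
    (q : G.E → K) (S : Finset G.V) (v : G.V → A) :
    (G.proj S).synergy (G.projValue q S v) = G.projSynergy q S (G.synergy v) :=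
  ((G.proj S).eq_synergy fun _ => rfl).symm

/-- Projecting to the roots and one further vertex gives a flat hierarchy. -/
theorem isFlat_proj {S : Finset G.V} {y : G.V} (hS : ∀ z, z ∈ S ↔ ¬ G.IsRoot z ∧ z ≠ y) :
    (G.proj S).IsFlat := by
  have hr : ∀ z ∈ S, ¬ G.IsRoot z := fun z hz => ((hS z).1 hz).1
  have h1 : ∀ x : (G.proj S).V, ¬ (G.proj S).IsRoot x → x.1 = y := by
    intro x hx
    by_contra h
    exact x.2 ((hS x.1).2 ⟨fun h' => hx (G.isRoot_proj x h'), h⟩)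
  intro x
  by_contra! h
  obtain ⟨hx, hl⟩ := h
  simp only [IsLeaf, not_forall, not_not] at hl
  obtain ⟨z, hz⟩ := hl
  have hzr : ¬ (G.proj S).IsRoot z := fun h => h x hz
  -- A non-root with a child would give two non-roots of the projection, both equal to `y`, hence a
  -- loop.
  obtain rfl : x = z := Subtype.ext ((h1 x hx).trans (h1 z hzr).symm)
  exact (G.proj S).isParent_wf.asymmetric x x hz hz

end DAMG

/-! ### Conservation of the harmonic pairing under projection -/

/-- Removing `z` replaces `c(z) w(z)` by `∑ c(x) q(x,z) w(z)`, which is the same by harmonicity at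
`z`. The set `U` holds the vertices still present; sums run over `U` only, because values at removed
vertices are stale. -/
theorem DAMG.sum_projSynList {X : Type v} [DecidableEq X] {K : Type u} [CommRing K] {A : Type w}
    [AddCommGroup A] [Module K A] (lt : X → X → Prop) [IsStrictOrder X lt] (c : X → K)
    (l : List X) (hl : l.Nodup) (U : Finset X) (hU : ∀ z ∈ l, z ∈ U) (q : X → X → K)
    (hq : ∀ x y, ¬ lt x y → q x y = 0) (hc : ∀ z ∈ l, c z = ∑ x ∈ U, c x * q x z) (w : X → A) :
    ∑ x ∈ U \ l.toFinset, c x • projSynList l q w x = ∑ x ∈ U, c x • w x := by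
  induction l generalizing U q w with
  | nil => simp [projSynList]
  | cons z l ih =>
    have hz : z ∈ U := hU z (by simp)
    rw [List.nodup_cons] at hl
    have hcz : ∑ x ∈ U.erase z, c x * q x z = c z := by
      rw [hc z (by simp), ← Finset.sum_erase_add _ _ hz, hq z z (irrefl z), mul_zero, add_zero]
    have h := ih hl.2 (U.erase z)
      (fun x hx => Finset.mem_erase.2 ⟨fun h => hl.1 (h ▸ hx), hU x (by simp [hx])⟩)
      (projPair q z) ?_ ?_ (projSyn q z w)
    · rw [projSynList, show U \ (z :: l).toFinset = U.erase z \ l.toFinset by ext; simp; tauto, h]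
      simp only [projSyn, smul_add, Finset.sum_add_distrib, smul_smul]
      rw [← Finset.sum_smul, hcz, Finset.sum_erase_add _ _ hz]
    -- The new weights still respect the order, by transitivity through `z`.
    · intro x y hxy
      rw [projPair, hq x y hxy]
      by_cases h1 : lt x z
      · rw [hq z y fun h2 => hxy (_root_.trans h1 h2)]; simp
      · rw [hq x z h1]; simp
    -- `c` remains harmonic at the later vertices: the added terms `c(x) q(x,z) q(z,y)` sum to `c(z)
    -- q(z,y)`, the term lost with `z`.
    · intro y hy
      simp only [projPair, mul_add, Finset.sum_add_distrib, ← mul_assoc]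
      rw [← Finset.sum_mul, hcz, Finset.sum_erase_add U (fun x => c x * q x y) hz]
      exact hc y (by simp [hy])

theorem DAMG.sum_projSynergy (G : DAMG.{v}) {K : Type u} [CommRing K] {A : Type w}
    [AddCommGroup A] [Module K A] {q : G.E → K} {c : G.V → K} (hc : G.IsHarmonic q c)
    {S : Finset G.V} (hS : ∀ z ∈ S, ¬ G.IsRoot z) (w : G.V → A) :
    ∑ x : (G.proj S).V, c x.1 • G.projSynergy q S w x = ∑ x, c x • w x := by
  classical
  obtain ⟨lt, hlt, hq⟩ := G.exists_strictOrder_pairWeight q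
  have h : ∀ x, x ∈ Finset.univ \ S.toList.toFinset ↔ x ∉ S := fun x => by simp
  rw [← sum_projSynList lt c S.toList S.nodup_toList Finset.univ (fun z _ => Finset.mem_univ z)
    (G.pairWeight q) hq
    (fun z hz => isHarmonic_iff_pairWeight.1 hc z (hS z (by simpa using hz))) w]
  exact (Finset.sum_subtype _ h
    fun x => c x • projSynList S.toList (G.pairWeight q) w x).symm

/-! ### Strengths -/

namespace RDAMG

variable {R : Type u} [CommRing R] (G : RDAMG.{u, v} R)

theorem isHarmonic_strength : G.IsHarmonic G.ς G.strength := fun _ hy => G.strength_nonroot hy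

theorem strength_eq_sum (z : G.V) :
    G.strength z = open scoped Classical in
      ∑ r : G.Root, G.τ r * G.totalWeight G.ς r.1 z := by
  classical
  refine congrFun (G.isHarmonic_strength.ext
    (DAMG.IsHarmonic.sum Finset.univ G.τ fun r _ => G.isHarmonic_totalWeight G.ς r.2)
    fun y hy => ?_) z
  rw [Finset.sum_eq_single_of_mem ⟨y, hy⟩ (Finset.mem_univ _), G.strength_root hy,
    G.totalWeight_self, mul_one]
  intro r _ hr
  rw [G.totalWeight_root G.ς (fun h => hr (Subtype.ext h)) hy, mul_zero]

theorem frac_mul_cancel (a : R) {y : G.V} (hy : ¬ G.IsRoot y) :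
    G.frac a (G.strength y) * algebraMap R G.Loc (G.strength y) = algebraMap R G.Loc a := by
  rw [frac, mul_assoc, Ring.inverse_mul_cancel _ (G.isUnit_strength_nonroot hy), mul_one]

/-! ### The coefficients `(τ(r) / τ(y)) σ(r,y)` -/

theorem coe_coef_nonroot (r : G.Root) {y : G.V} (hy : ¬ G.IsRoot y) :
    (G.coef r.1 y : G.Loc) = G.frac (G.τ r * G.totalWeight G.ς r.1 y) (G.strength y) := by
  have hry : r.1 ≠ y := fun h => hy (h ▸ r.2)
  change G.ratio r.1 y * algebraMap R G.Loc (G.totalWeight G.ς r.1 y) = _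
  rw [ratio, if_neg hry, G.strength_root r.2, frac, frac, map_mul]
  ring

theorem coef_self (x : G.V) : G.coef x x = 1 := by
  apply Subtype.ext
  change G.ratio x x * algebraMap R G.Loc (G.totalWeight G.ς x x) = 1
  rw [G.totalWeight_self, ratio, if_pos rfl, map_one, one_mul]

theorem coef_of_not_isAnc {x y : G.V} (h : ¬ G.IsAnc x y) : G.coef x y = 0 := by
  apply Subtype.ext
  change G.ratio x y * algebraMap R G.Loc (G.totalWeight G.ς x y) = 0
  rw [G.totalWeight_of_not_isAnc _ h, map_zero, mul_zero]

theorem coef_root {x y : G.V} (hxy : x ≠ y) (hy : G.IsRoot y) : G.coef x y = 0 :=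
  G.coef_of_not_isAnc (G.not_isAnc_root hxy hy)

/-- Multiplied by `τ(y)`, the coefficient becomes `τ(r) σ(r,y)`. -/
theorem coe_coef_mul_strength (r : G.Root) (y : G.V) :
    (G.coef r.1 y : G.Loc) * algebraMap R G.Loc (G.strength y)
      = algebraMap R G.Loc (G.τ r * G.totalWeight G.ς r.1 y) := by
  -- At a root `τ(y)` need not be invertible, but there the coefficient is `1` or `0`.
  by_cases hy : G.IsRoot y
  · by_cases h : r.1 = y
    · obtain rfl : r = ⟨y, hy⟩ := Subtype.ext h
      rw [coef_self, G.strength_root hy, G.totalWeight_self]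
      simp
    · rw [G.coef_root h hy, G.totalWeight_root _ h hy]
      simp
  · rw [G.coe_coef_nonroot r hy, G.frac_mul_cancel _ hy]

/-- The numerator `τ(t e)` of `q(e)` clears the denominator of the coefficient at `t e`. Using
`coe_coef_mul_strength` for this also covers tails that are roots; what remains is harmonicity of
`σ(r,·)` divided by `τ(y)`. -/
theorem isHarmonic_coef (r : G.Root) : G.IsHarmonic G.q (G.coef r.1) := by
  classical
  intro y hy
  apply Subtype.ext
  have h2 : ((∑ e : G.E with G.h e = y, G.coef r.1 (G.t e) * G.q e : G.Rq) : G.Loc)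
      = ∑ e : G.E with G.h e = y, (G.coef r.1 (G.t e) : G.Loc) * G.qLoc e :=
    map_sum G.subalgebraRq.val _ _
  rw [h2, G.coe_coef_nonroot r hy, G.isHarmonic_totalWeight G.ς r.2 y hy, Finset.mul_sum, frac,
    map_sum, Finset.sum_mul]
  refine Finset.sum_congr rfl fun e he => ?_
  obtain rfl : G.h e = y := by simpa using he
  have h3 := G.coe_coef_mul_strength r (G.t e)
  rw [map_mul] at h3
  rw [qLoc, frac, map_mul, map_mul]
  linear_combination (-Ring.inverse (algebraMap R G.Loc (G.strength (G.h e))) *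
    algebraMap R G.Loc (G.ς e)) * h3

/-- Both sides are harmonic for `q`, the right one because `q` is normalized, and both are `1` on
the roots. -/
theorem sum_coef_root (y : G.V) : open scoped Classical in ∑ r : G.Root, G.coef r.1 y = 1 := by
  classical
  have h := DAMG.IsHarmonic.sum Finset.univ (fun _ => (1 : G.Rq))
    fun (r : G.Root) _ => G.isHarmonic_coef r
  simp only [one_mul] at h
  refine congrFun (h.ext G.q_normalized.isHarmonic_one fun y hy => ?_) y
  rw [Finset.sum_eq_single_of_mem ⟨y, hy⟩ (Finset.mem_univ _), coef_self]
  exact fun r _ hr => G.coef_root (fun h => hr (Subtype.ext h)) hy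

theorem coe_projHom {S : Finset G.V} (hS : ∀ z ∈ S, ¬ G.IsRoot z) (a : (G.proj S).Rq) :
    (G.projHom S hS a : G.Loc) = G.projLocHom S hS a := rfl

theorem projHom_coef {S : Finset G.V} (hS : ∀ z ∈ S, ¬ G.IsRoot z) (r : G.Root)
    (x : (G.proj S).V) :
    G.projHom S hS ((G.proj S).coef (G.projRoot S hS r).1 x) = G.coef r.1 x.1 := by
  by_cases hx : G.IsRoot x.1
  · by_cases h : r.1 = x.1
    · obtain rfl : (G.projRoot S hS r).1 = x := Subtype.ext h
      refine (congrArg _ ((G.proj S).coef_self (G.projRoot S hS r).1)).trans ?_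
      exact (map_one _).trans (G.coef_self r.1).symm
    · have h' : (G.projRoot S hS r).1 ≠ x := fun h' => h (congrArg Subtype.val h')
      refine (congrArg _ ((G.proj S).coef_root h' (G.isRoot_proj x hx))).trans ?_
      exact (map_zero _).trans (G.coef_root h hx).symm
  · have h1 := congrArg (G.projLocHom S hS)
      ((G.proj S).coe_coef_mul_strength (G.projRoot S hS r) x)
    rw [map_mul, AlgHom.commutes, AlgHom.commutes, G.strength_proj hS] at h1
    apply Subtype.ext
    rw [coe_projHom]
    -- After multiplication by the unit `τ(x)` both sides are the image of `τ(r) σ(r,x)`.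
    refine (G.isUnit_strength_nonroot hx).mul_left_injective ?_
    change _ * _ = _ * _
    rw [h1, G.coe_coef_mul_strength]
    congr 2
    · exact G.strength_root r.2
    · exact G.totalWeight_proj hS G.ς r x

theorem strength_aut (α : G.Aut) (y : G.V) : G.strength (α.onV y) = G.strength y := by
  refine congrFun ((DAMG.isHarmonic_comp_aut α.toAut α.ς_map G.isHarmonic_strength).ext
    G.isHarmonic_strength fun y hy => ?_) y
  rw [G.strength_root hy, ← α.τ_map]
  exact G.strength_root (α.isRoot_map hy)

theorem q_aut (α : G.Aut) (e : G.E) : G.q (α.onE e) = G.q e := by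
  apply Subtype.ext
  change G.qLoc _ = G.qLoc _
  rw [qLoc, qLoc, α.t_map, α.h_map, strength_aut, strength_aut, α.ς_map]

theorem coef_aut (α : G.Aut) (r : G.Root) (y : G.V) :
    G.coef (α.onV r.1) (α.onV y) = G.coef r.1 y := by
  refine congrFun ((DAMG.isHarmonic_comp_aut α.toAut (G.q_aut α)
    (G.isHarmonic_coef (α.onRoot r))).ext (G.isHarmonic_coef r) fun y hy => ?_) y
  by_cases h : r.1 = y
  · subst h
    exact (G.coef_self _).trans (G.coef_self _).symm
  · rw [G.coef_root h hy]
    exact G.coef_root (fun h' => h (α.onV.injective h')) (α.isRoot_map hy)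

end RDAMG

/-! ### The explicit rule -/

section explicitRule

variable (R : Type u) [CommRing R]

theorem explicitRule_explicitFormula : (explicitRule.{u, v} R).ExplicitFormula :=
  fun _ _ _ _ _ _ => rfl

theorem explicitRule_aLinearity : (explicitRule.{u, v} R).ALinearity := by
  intro G A _ _ I _ a v r
  simp only [explicitRule, G.synergy_sum_smul', Finset.smul_sum, Finset.sum_smul, smul_eq_mul,
    smul_smul]
  exact Finset.sum_comm

theorem explicitRule_rLinearity : (explicitRule.{u, v} R).RLinearity := by
  intro G A _ _ v₁ v₂ c₁ c₂ r
  have h := G.synergy_sum_smul Finset.univ ![c₁, c₂] ![v₁, v₂]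
  simp only [Fin.sum_univ_two, Matrix.cons_val_zero, Matrix.cons_val_one] at h
  simp only [explicitRule, h, smul_add, Finset.sum_add_distrib, Finset.smul_sum, smul_smul,
    mul_comm]

theorem explicitRule_weakElements : (explicitRule.{u, v} R).WeakElements := by
  intro G A _ _ v W hW hv r
  refine (G.sum_proj W (fun y => G.coef r.1 y • G.synergy v y)
    fun z hz => by rw [hv z hz, smul_zero]).symm.trans ?_
  refine Finset.sum_congr rfl fun x _ => ?_
  rw [← G.projHom_coef hW r x]
  exact congrArg _ (congrFun (G.synergy_restrict v hv) x).symm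

theorem explicitRule_projection : (explicitRule.{u, v} R).Projection := by
  intro G A _ _ v S hS r
  refine (G.sum_projSynergy (G.isHarmonic_coef r) hS (G.synergy v)).symm.trans ?_
  refine Finset.sum_congr rfl fun x _ => ?_
  rw [← G.projHom_coef hS r x]
  exact congrArg _ (congrFun (G.synergy_projValue G.q S v) x).symm

theorem explicitRule_unanimity (G : RDAMG.{u, v} R) (y : G.V) (r : G.Root) :
    explicitRule R G G.Rq (G.unanimity G.Rq y) r = G.coef r.1 y := by
  classical
  simp [explicitRule, G.synergy_unanimity, Pi.single_apply]

theorem RDAMG.coe_coef_of_isFlat {R : Type u} [CommRing R] (G : RDAMG.{u, v} R) (hG : G.IsFlat)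
    {y : G.V} (hy : ¬ G.IsRoot y) (r : G.Root) :
    open scoped Classical in (G.coef r.1 y : G.Loc) =
      G.frac (G.τ r * G.pairWeight G.ς r.1 y) (∑ u : G.Root, G.τ u * G.pairWeight G.ς u.1 y) := by
  rw [G.coe_coef_nonroot r hy, G.strength_eq_sum y]
  simp only [fun u : G.Root => G.totalWeight_of_isFlat G.ς hG u.2 hy]

theorem explicitRule_flatHierarchy : (explicitRule.{u, v} R).FlatHierarchy := by
  intro G hG y r
  rw [explicitRule_unanimity]
  refine ⟨fun hy => ?_, fun hy => G.coe_coef_of_isFlat hG hy r⟩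
  split_ifs with h
  · rw [h, G.coef_self]
  · exact G.coef_root h hy

theorem explicitRule_inducedProjectionWeights :
    (explicitRule.{u, v} R).InducedProjectionWeights := by
  classical
  intro G A _ _ v r
  have hS : ∀ z ∈ (Finset.univ.filter fun z => ¬ G.IsRoot z), ¬ G.IsRoot z := by simp
  refine (G.sum_projSynergy (G.isHarmonic_coef r) hS (G.synergy v)).symm.trans ?_
  -- Only roots remain after the projection, and on them the coefficient is the indicator of `r`.
  rw [Finset.sum_eq_single_of_mem (G.projRoot _ hS r).1 (Finset.mem_univ _)]
  · refine (congrArg (· • _) (G.coef_self r.1)).trans ?_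
    rw [one_smul]
    rfl
  · intro x _ hx
    have hxr : G.IsRoot x.1 := by simpa using x.2
    refine (congrArg (· • _) (G.coef_root (fun h => hx ?_) hxr)).trans (zero_smul _ _)
    exact Subtype.ext h.symm

theorem explicitRule_efficiency : (explicitRule.{u, v} R).Efficiency := by
  classical
  intro G A _ _ v
  simp only [explicitRule]
  rw [Finset.sum_comm]
  refine Finset.sum_congr rfl fun y _ => ?_
  rw [← Finset.sum_smul, G.sum_coef_root, one_smul]

theorem explicitRule_nullRoot : (explicitRule.{u, v} R).NullRoot := by
  intro G A _ _ v r hr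
  refine Finset.sum_eq_zero fun y _ => ?_
  by_cases h : G.IsAnc r.1 y
  · rw [hr y h, smul_zero]
  · rw [G.coef_of_not_isAnc h, zero_smul]

theorem explicitRule_symmetry : (explicitRule.{u, v} R).Symmetry := by
  intro G A _ _ v α r
  have h : explicitRule R G A v (α.onRoot r)
      = ∑ y, G.coef r.1 y • G.synergy v (α.onV y) := by
    rw [explicitRule, ← Equiv.sum_comp α.onV]
    exact Finset.sum_congr rfl fun y _ => congrArg (· • _) (G.coef_aut α r y)
  rw [h]
  refine ⟨?_, fun hv => Finset.sum_congr rfl fun y _ => ?_⟩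
  · rw [explicitRule, DAMG.synergy_comp_aut α.toAut]
  · by_cases hy : G.IsAnc r.1 y
    · rw [hv y hy]
    · rw [G.coef_of_not_isAnc hy, zero_smul, zero_smul]

end explicitRule

/-! ### Uniqueness -/

namespace Rule

variable {R : Type u} [CommRing R] {Sh : Rule.{u, v} R}

theorem ALinearity.sum (h : Sh.ALinearity) (G : RDAMG.{u, v} R) (A : Type u) [AddCommGroup A]
    [Module G.Rq A] {I : Type*} [Fintype I] (a : I → A) (v : I → G.V → G.Rq) (r : G.Root) :
    Sh G A (fun x => ∑ i, v i x • a i) r = ∑ i, Sh G G.Rq (v i) r • a i := by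
  -- The axiom is stated for index types in `Type`, while the vertices live in another universe;
  -- `Fin` bridges the two.
  have e := (Fintype.equivFin I).symm
  have := h G A (Fin (Fintype.card I)) (fun i => a (e i)) (fun i => v (e i)) r
  rw [e.sum_comp fun i => Sh G G.Rq (v i) r • a i] at this
  rw [← this]
  congr 1
  funext x
  exact (e.sum_comp fun i => v i x • a i).symm

theorem ALinearity.smul (h : Sh.ALinearity) (G : RDAMG.{u, v} R) (A : Type u) [AddCommGroup A]
    [Module G.Rq A] (a : A) (v : G.V → G.Rq) (r : G.Root) :
    Sh G A (fun x => v x • a) r = Sh G G.Rq v r • a := by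
  simpa using h.sum G A (fun _ : Unit => a) (fun _ => v) r

theorem FlatHierarchy.unanimity (h : Sh.FlatHierarchy) (G : RDAMG.{u, v} R) (hG : G.IsFlat)
    (y : G.V) (r : G.Root) : Sh G G.Rq (G.unanimity G.Rq y) r = G.coef r.1 y := by
  by_cases hy : G.IsRoot y
  · rw [(h G hG y r).1 hy]
    split_ifs with hr
    · rw [hr, G.coef_self]
    · rw [G.coef_root hr hy]
  · apply Subtype.ext
    rw [(h G hG y r).2 hy, G.coe_coef_of_isFlat hG hy]

theorem unanimity_eq_coef (hA : Sh.ALinearity) (hW : Sh.WeakElements) (hF : Sh.FlatHierarchy)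
    (G : RDAMG.{u, v} R) (y : G.V) (r : G.Root) :
    Sh G G.Rq (G.unanimity G.Rq y) r = G.coef r.1 y := by
  classical
  -- All of these are weak, since the synergy of `ζ_y` is the indicator of `y`.
  let W : Finset G.V := Finset.univ.filter fun z => ¬ G.IsRoot z ∧ z ≠ y
  have hW1 : ∀ z, z ∈ W ↔ ¬ G.IsRoot z ∧ z ≠ y := by simp [W]
  have hW2 : ∀ z ∈ W, ¬ G.IsRoot z := fun z hz => ((hW1 z).1 hz).1
  have hy : y ∉ W := fun h => ((hW1 y).1 h).2 rfl
  rw [hW G G.Rq _ W hW2 (fun z hz => by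
    rw [DAMG.IsWeak, G.synergy_unanimity, Pi.single_eq_of_ne ((hW1 z).1 hz).2]) r]
  let _ := G.projModule W hW2 G.Rq
  let y' : (G.proj W).V := ⟨y, hy⟩
  -- The restricted function takes values in the ring of `G`, whereas the flat axiom concerns the
  -- ring of the projection. Written as a scalar function times the vector `1`, it is brought to the
  -- latter by `A`-linearity.
  have h1 : G.restrict W (G.unanimity G.Rq y)
      = fun x => (G.proj W).unanimity (G.proj W).Rq y' x • (1 : G.Rq) := by
    funext x
    refine (congrFun (G.restrict_unanimity G.Rq W y') x).trans ?_
    by_cases hx : (G.proj W).IsAnc y' x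
    · exact (if_pos hx).trans ((congrArg (· • (1 : G.Rq)) (if_pos hx)).trans
        (one_smul (G.proj W).Rq (1 : G.Rq))).symm
    · exact (if_neg hx).trans ((congrArg (· • (1 : G.Rq)) (if_neg hx)).trans
        (zero_smul (G.proj W).Rq (1 : G.Rq))).symm
  rw [h1]
  refine (hA.smul (G.proj W) G.Rq 1 _ _).trans ?_
  refine (congrArg (· • (1 : G.Rq))
    (hF.unanimity (G.proj W) (G.isFlat_proj hW1) y' (G.projRoot W hW2 r))).trans ?_
  -- A scalar of the projected ring acts on `1` by its image under `projHom`.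
  exact (mul_one (G.projHom W hW2 _)).trans (G.projHom_coef hW2 r y')

theorem eq_explicitRule (hA : Sh.ALinearity) (hW : Sh.WeakElements) (hF : Sh.FlatHierarchy) :
    Sh = explicitRule R := by
  funext G A _ _ v r
  conv_lhs => rw [G.eq_sum_unanimity_smul (K := G.Rq) v]
  rw [hA.sum]
  exact Finset.sum_congr rfl fun y _ => congrArg (· • _) (unanimity_eq_coef hA hW hF G y r)

end Rule

theorem mainTheorem7 (R : Type u) [CommRing R] :
    (∀ (G : RDAMG.{u, v} R) (z : G.V),
      G.strength z = open scoped Classical in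
        ∑ r : G.Root, G.τ r * G.totalWeight G.ς r.1 z) ∧
    (∀ Sh : Rule.{u, v} R, Sh.ALinearity → Sh.WeakElements → Sh.FlatHierarchy →
      Sh.ExplicitFormula ∧ Sh.InducedProjectionWeights ∧ Sh.RLinearity ∧ Sh.Efficiency ∧
        Sh.NullRoot ∧ Sh.Projection ∧ Sh.Symmetry) ∧
    ((explicitRule.{u, v} R).ALinearity ∧ (explicitRule.{u, v} R).WeakElements ∧
      (explicitRule.{u, v} R).FlatHierarchy ∧ (explicitRule.{u, v} R).ExplicitFormula ∧
      (explicitRule.{u, v} R).InducedProjectionWeights ∧ (explicitRule.{u, v} R).RLinearity ∧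
      (explicitRule.{u, v} R).Efficiency ∧ (explicitRule.{u, v} R).NullRoot ∧
      (explicitRule.{u, v} R).Projection ∧ (explicitRule.{u, v} R).Symmetry) := by
  refine ⟨fun G z => G.strength_eq_sum z, ?_, explicitRule_aLinearity R,
    explicitRule_weakElements R, explicitRule_flatHierarchy R, explicitRule_explicitFormula R,
    explicitRule_inducedProjectionWeights R, explicitRule_rLinearity R, explicitRule_efficiency R,
    explicitRule_nullRoot R, explicitRule_projection R, explicitRule_symmetry R⟩
  intro Sh hA hW hF
  rw [Rule.eq_explicitRule hA hW hF]
  exact ⟨explicitRule_explicitFormula R, explicitRule_inducedProjectionWeights R,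
    explicitRule_rLinearity R, explicitRule_efficiency R, explicitRule_nullRoot R,
    explicitRule_projection R, explicitRule_symmetry R⟩
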